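/- A ray (double ray) of a graph is a one-way (two-way) infinite path in it. Let $G$ be a (simple, possibly infinite) graph for which the algebraic-cycle matroid $M_A(G)$ exists, i.e. for which there is a (necessarily unique) matroid $M_A(G)$, in the sense of infinite matroids, with ground set $E(G)$ whose circuits are exactly the edge sets of the finite cycles and of the double rays of $G$. The finitarization $M^{\mathrm{fin}}$ of a matroid $M$ is the matroid on the same ground set whose circuits are the finite circuits of $M$, and $M$ is nearly finitary if every base $B^{\mathrm{fin}}$ of $M^{\mathrm{fin}}$ contains a base $B$ of $M$ with $B^{\mathrm{fin}}\setminus B$ finite. Say that $G$ has only a finite number of vertex-disjoint rays if there is a $k\in\mathbb{N}$ such that every set of pairwise vertex-disjoint rays of $G$ has at most $k$ elements. If $G$ has only a finite number of vertex-disjoint rays, then $M_A(G)$ is nearly finitary. If $G$ is connected, then $M_A(G)$ is nearly finitary if and only if $G$ has only a finite number of vertex-disjoint rays. -/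

import Mathlib

namespace Matroid

variable {α : Type*}

/-- The independent sets of the finitarization: the subsets of the ground set that contain no
finite circuit of `M`. -/
def FinitarizationIndep (M : Matroid α) (I : Set α) : Prop :=
  I ⊆ M.E ∧ ∀ C, M.IsCircuit C → C.Finite → ¬ C ⊆ I

theorem finitarizationIndep_iff_of_finite (M : Matroid α) {I : Set α} (hI : I.Finite) :
    M.FinitarizationIndep I ↔ M.Indep I := by
  rw [indep_iff_forall_subset_not_isCircuit']
  exact ⟨fun h ↦ ⟨fun C hCI hC ↦ h.2 C hC (hI.subset hCI) hCI, h.1⟩,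
    fun h ↦ ⟨h.2, fun C hC _ hCI ↦ h.1 C hCI hC⟩⟩

/-- The finitarization of `M`: the matroid on the ground set of `M` whose circuits are the finite
circuits of `M`; see `finitarization_isCircuit_iff`. -/
def finitarization (M : Matroid α) : Matroid α :=
  (IndepMatroid.ofFinitaryCardAugment M.E M.FinitarizationIndep
    (by rw [finitarizationIndep_iff_of_finite M Set.finite_empty]; exact M.empty_indep)
    (fun _ _ hJ hIJ ↦ ⟨hIJ.trans hJ.1, fun C hC hfin hCI ↦ hJ.2 C hC hfin (hCI.trans hIJ)⟩)
    (by
      intro I J hI hIfin hJ hJfin hlt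
      rw [finitarizationIndep_iff_of_finite M hIfin] at hI
      rw [finitarizationIndep_iff_of_finite M hJfin] at hJ
      obtain ⟨e, he, hins⟩ := hI.augment hJ (by
        rw [← hIfin.cast_ncard_eq, ← hJfin.cast_ncard_eq]; exact_mod_cast hlt)
      exact ⟨e, he.1, he.2, (finitarizationIndep_iff_of_finite M (hIfin.insert e)).2 hins⟩)
    (fun I h ↦ ⟨fun e he ↦ (h {e} (by simpa using he) (Set.finite_singleton e)).1 rfl,
      fun C hC hfin hCI ↦ (h C hCI hfin).2 C hC hfin subset_rfl⟩)
    (fun _ h ↦ h.1)).matroid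

theorem finitarization_ground (M : Matroid α) : M.finitarization.E = M.E := rfl

theorem finitarization_indep_iff (M : Matroid α) {I : Set α} :
    M.finitarization.Indep I ↔ I ⊆ M.E ∧ ∀ C, M.IsCircuit C → C.Finite → ¬ C ⊆ I := Iff.rfl

theorem finitarization_isCircuit_iff (M : Matroid α) {C : Set α} :
    M.finitarization.IsCircuit C ↔ M.IsCircuit C ∧ C.Finite := by
  have key : ∀ D, M.finitarization.Dep D ↔
      D ⊆ M.E ∧ ∃ C', M.IsCircuit C' ∧ C'.Finite ∧ C' ⊆ D := by
    intro D
    rw [Dep, finitarization_indep_iff, finitarization_ground]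
    constructor
    · rintro ⟨h, hE⟩
      by_contra! hcon
      exact h ⟨hE, fun C' hC' hfin ↦ hcon hE C' hC' hfin⟩
    · rintro ⟨hE, C', hC', hfin, hsub⟩
      exact ⟨fun h ↦ h.2 C' hC' hfin hsub, hE⟩
  constructor
  · intro h
    obtain ⟨hE, C', hC', hfin, hsub⟩ := (key C).1 h.dep
    have heq : C' = C :=
      subset_antisymm hsub (h.2 ((key C').2 ⟨hsub.trans hE, C', hC', hfin, subset_rfl⟩) hsub)
    exact heq ▸ ⟨hC', hfin⟩
  · rintro ⟨hC, hfin⟩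
    refine ⟨(key C).2 ⟨hC.subset_ground, C, hC, hfin, subset_rfl⟩, fun D hD hDC ↦ ?_⟩
    obtain ⟨-, C', hC', -, hsub⟩ := (key D).1 hD
    exact (hC.2 hC'.dep (hsub.trans hDC)).trans hsub

/-- `M` is nearly finitary: every base of its finitarization contains a base of `M` such that
their difference is finite. -/
def NearlyFinitary (M : Matroid α) : Prop :=
  ∀ B, M.finitarization.IsBase B → ∃ B', M.IsBase B' ∧ B' ⊆ B ∧ (B \ B').Finite

end Matroid

namespace SimpleGraph

variable {V : Type*}

/-- A ray of `G`, as the sequence of its vertices: a one-way infinite path. -/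
def IsRay (G : SimpleGraph V) (r : ℕ → V) : Prop :=
  Function.Injective r ∧ ∀ n, G.Adj (r n) (r (n + 1))

/-- A double ray of `G`, as the sequence of its vertices: a two-way infinite path. -/
def IsDoubleRay (G : SimpleGraph V) (d : ℤ → V) : Prop :=
  Function.Injective d ∧ ∀ n, G.Adj (d n) (d (n + 1))

/-- `C` is the edge set of a finite cycle of `G`. -/
def IsCycleEdgeSet (G : SimpleGraph V) (C : Set (Sym2 V)) : Prop :=
  ∃ (v : V) (c : G.Walk v v), c.IsCycle ∧ C = {e | e ∈ c.edges}

/-- `C` is the edge set of a double ray of `G`. -/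
def IsDoubleRayEdgeSet (G : SimpleGraph V) (C : Set (Sym2 V)) : Prop :=
  ∃ d : ℤ → V, G.IsDoubleRay d ∧ C = Set.range fun n : ℤ ↦ s(d n, d (n + 1))

/-- `M` is the algebraic-cycle matroid of `G`: its ground set is the edge set of `G`, and its
circuits are the edge sets of the finite cycles and of the double rays of `G`. There is at most one
such matroid (`IsAlgebraicCycleMatroid.unique`); for some graphs there is none. -/
def IsAlgebraicCycleMatroid (G : SimpleGraph V) (M : Matroid (Sym2 V)) : Prop :=
  M.E = G.edgeSet ∧ ∀ C, M.IsCircuit C ↔ G.IsCycleEdgeSet C ∨ G.IsDoubleRayEdgeSet C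

theorem IsAlgebraicCycleMatroid.unique {G : SimpleGraph V} {M M' : Matroid (Sym2 V)}
    (h : G.IsAlgebraicCycleMatroid M) (h' : G.IsAlgebraicCycleMatroid M') : M = M' :=
  Matroid.ext_isCircuit (h.1.trans h'.1.symm) fun C _ ↦ (h.2 C).trans (h'.2 C).symm

/-- `G` has only a finite number of vertex-disjoint rays: for some `k`, every set of pairwise
vertex-disjoint rays of `G` has at most `k` elements. -/
def HasFinitelyManyDisjointRays (G : SimpleGraph V) : Prop :=
  ∃ k : ℕ, ∀ R : Set (ℕ → V), (∀ r ∈ R, G.IsRay r) → R.PairwiseDisjoint Set.range → R.encard ≤ k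

end SimpleGraph

namespace SimpleGraph

variable {V : Type*}

/-! Double rays are infinite, so the finite circuits of `M` are the finite cycles, and the bases of
the finitarization are the maximal forests `F` of `G`.

Few rays: `F` spans `M`, so a maximal `M`-independent `B ⊆ F` is a base. For `e ∈ F \ B`, a circuit
in `B + e` must be a double ray through `e`, since `F` has no cycle; without `e` it leaves a ray of
`B` at each end of `e`. Thus `e` joins components of `B` that contain rays. There are finitely many
of these, as rays in distinct components are disjoint, and two edges of `F \ B` joining the same
pair would close a cycle in `F`. Hence `F \ B` is finite.

Many rays, `G` connected: by Halin's theorem there are infinitely many disjoint rays. Their union is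
a forest and extends to a spanning tree `T`. If a base `B ⊆ T` missed only finitely many edges of
`T`, infinitely many of the rays would lie in `B`, and `B` would have finitely many components. Two
of the rays would then be connected in `B`, giving a double ray in `B`, a contradiction.

Halin's theorem is proved by enlarging a finite family one ray at a time while fixing growing
initial segments; a stable matching decides where old rays switch to new ones. -/

/-! ### Rays and double rays -/

theorem IsRay.reachable {G : SimpleGraph V} {r : ℕ → V} (hr : G.IsRay r) (n : ℕ) :
    G.Reachable (r 0) (r n) := by
  induction n with
  | zero => rfl
  | succ n ih => exact ih.trans (hr.2 n).reachable

theorem IsRay.exists_isDoubleRay_of_adj {G : SimpleGraph V} {r s : ℕ → V} (hr : G.IsRay r)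
    (hs : G.IsRay s) (hd : Disjoint (Set.range r) (Set.range s)) {a b : ℕ}
    (hab : G.Adj (r a) (s b)) : ∃ d, G.IsDoubleRay d := by
  have hne : ∀ m n, r m ≠ s n := fun m n h ↦ Set.disjoint_left.1 hd ⟨m, rfl⟩ ⟨n, h.symm⟩
  -- Nonnegative integers follow `s` from `b`, negative ones follow `r` from `a`; the edge from `-1`
  -- to `0` is the given one.
  refine ⟨fun n ↦ Int.rec (fun k ↦ s (b + k)) (fun k ↦ r (a + k)) n, ?_, ?_⟩
  · rintro (m | m) (n | n) h
    · have := hs.1 h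
      congr 1
      omega
    · exact absurd (Eq.symm h) (hne _ _)
    · exact absurd h (hne _ _)
    · have := hr.1 h
      congr 1
      omega
  · rintro (n | _ | n)
    · exact hs.2 (b + n)
    · exact hab
    · exact (hr.2 (a + n)).symm

/-- Push the start of the first ray along a walk towards `s`: a step to a new vertex is prepended to
the tail of the current ray, and a step onto `s` links the two rays. -/
theorem IsRay.exists_isDoubleRay_of_reachable {G : SimpleGraph V} {r s : ℕ → V} (hr : G.IsRay r)
    (hs : G.IsRay s) (hd : Disjoint (Set.range r) (Set.range s))
    (hrs : G.Reachable (r 0) (s 0)) : ∃ d, G.IsDoubleRay d := by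
  obtain ⟨w⟩ := hrs
  suffices h : ∀ u v (_ : G.Walk u v), v ∈ Set.range s → ∀ r : ℕ → V, G.IsRay r →
      Disjoint (Set.range r) (Set.range s) → u ∈ Set.range r → ∃ d, G.IsDoubleRay d from
    h _ _ w ⟨0, rfl⟩ r hr hd ⟨0, rfl⟩
  intro u v w hv
  induction w with
  | nil => exact fun r _ hd hu ↦ absurd hv (Set.disjoint_left.1 hd hu)
  | @cons u w v huw p ih =>
    rintro r hr hd ⟨a, rfl⟩
    by_cases hws : w ∈ Set.range s
    · obtain ⟨b, rfl⟩ := hws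
      exact hr.exists_isDoubleRay_of_adj hs hd huw
    by_cases hwr : w ∈ Set.range r
    · exact ih hv r hr hd hwr
    refine ih hv (fun n ↦ Nat.rec w (fun k _ ↦ r (a + k)) n) ⟨?_, ?_⟩ ?_ ⟨0, rfl⟩
    · rintro (_ | m) (_ | n) h
      · rfl
      · exact absurd ⟨_, Eq.symm h⟩ hwr
      · exact absurd ⟨_, h⟩ hwr
      · have := hr.1 h
        congr 1
        omega
    · rintro (_ | n)
      · exact huw.symm
      · exact hr.2 (a + n)
    · rw [Set.disjoint_left]
      rintro _ ⟨_ | n, rfl⟩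
      · exact hws
      · exact Set.disjoint_left.1 hd ⟨a + n, rfl⟩

theorem IsDoubleRay.isRay_add {G : SimpleGraph V} {d : ℤ → V} (hd : G.IsDoubleRay d) (n : ℤ) :
    G.IsRay fun k : ℕ ↦ d (n + k) := by
  refine ⟨fun k l h ↦ ?_, fun k ↦ ?_⟩
  · have := hd.1 h
    omega
  · simpa [add_assoc] using hd.2 (n + k)

theorem IsDoubleRay.isRay_sub {G : SimpleGraph V} {d : ℤ → V} (hd : G.IsDoubleRay d) (n : ℤ) :
    G.IsRay fun k : ℕ ↦ d (n - k) := by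
  refine ⟨fun k l h ↦ ?_, fun k ↦ ?_⟩
  · have := hd.1 h
    omega
  · have := (hd.2 (n - (k + 1 : ℕ))).symm
    convert this using 2
    push_cast
    ring

theorem IsDoubleRay.sym2_injective {G : SimpleGraph V} {d : ℤ → V} (hd : G.IsDoubleRay d) :
    Function.Injective fun n : ℤ ↦ s(d n, d (n + 1)) := by
  intro m n h
  rcases Sym2.eq_iff.1 h with ⟨h, -⟩ | ⟨h, h'⟩
  · exact hd.1 h
  · have := hd.1 h
    have := hd.1 h'
    omega

theorem IsRay.fromEdgeSet {G : SimpleGraph V} {r : ℕ → V} (hr : G.IsRay r) {I : Set (Sym2 V)}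
    (h : ∀ n, s(r n, r (n + 1)) ∈ I) : (fromEdgeSet I).IsRay r :=
  ⟨hr.1, fun n ↦ (fromEdgeSet_adj _).2 ⟨h n, (hr.2 n).ne⟩⟩

/-! ### The finitarization and forests -/

theorem IsCycleEdgeSet.finite {G : SimpleGraph V} {C : Set (Sym2 V)} (hC : G.IsCycleEdgeSet C) :
    C.Finite := by
  obtain ⟨v, c, -, rfl⟩ := hC
  exact c.edges.finite_toSet

theorem IsDoubleRayEdgeSet.infinite {G : SimpleGraph V} {C : Set (Sym2 V)}
    (hC : G.IsDoubleRayEdgeSet C) : C.Infinite := by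
  obtain ⟨d, hd, rfl⟩ := hC
  exact Set.infinite_range_of_injective hd.sym2_injective

theorem isAcyclic_fromEdgeSet_iff {G : SimpleGraph V} {I : Set (Sym2 V)} (hI : I ⊆ G.edgeSet) :
    (fromEdgeSet I).IsAcyclic ↔ ∀ C, G.IsCycleEdgeSet C → ¬ C ⊆ I := by
  constructor
  · rintro h C ⟨v, c, hc, rfl⟩ hCI
    have he : ∀ e ∈ c.edges, e ∈ (fromEdgeSet I).edgeSet := fun e he ↦ by
      rw [edgeSet_fromEdgeSet]
      exact ⟨hCI he, fun hd ↦ G.not_isDiag_of_mem_edgeSet (hI (hCI he)) hd⟩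
    exact h (c.transfer _ he) (hc.transfer he)
  · intro h v c hc
    have hsub : ∀ e ∈ c.edges, e ∈ I := fun e he ↦ by
      have := c.edges_subset_edgeSet he
      rw [edgeSet_fromEdgeSet] at this
      exact this.1
    refine h _ ⟨v, c.transfer G fun e he ↦ hI (hsub e he), hc.transfer _, rfl⟩ fun e he ↦ ?_
    rw [Set.mem_ofPred_eq, Walk.edges_transfer] at he
    exact hsub e he

theorem IsAlgebraicCycleMatroid.finitarization_indep_iff {G : SimpleGraph V}
    {M : Matroid (Sym2 V)} (hM : G.IsAlgebraicCycleMatroid M) {I : Set (Sym2 V)} :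
    M.finitarization.Indep I ↔ I ⊆ G.edgeSet ∧ (fromEdgeSet I).IsAcyclic := by
  rw [M.finitarization_indep_iff, hM.1]
  refine and_congr_right fun hI ↦ ?_
  rw [isAcyclic_fromEdgeSet_iff hI]
  refine ⟨fun h C hC ↦ h C ((hM.2 C).2 (.inl hC)) hC.finite, fun h C hC hfin ↦ h C ?_⟩
  exact ((hM.2 C).1 hC).resolve_right fun h' ↦ h'.infinite hfin

/-! ### Finitely many disjoint rays imply nearly finitary -/

theorem finite_setOf_connectedComponent_of_hasFinitelyManyDisjointRays {G H : SimpleGraph V}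
    (hHG : H ≤ G) (hG : G.HasFinitelyManyDisjointRays) :
    {c : H.ConnectedComponent | ∃ r, H.IsRay r ∧ H.connectedComponentMk (r 0) = c}.Finite := by
  obtain ⟨k, hk⟩ := hG
  set S := {c : H.ConnectedComponent | ∃ r, H.IsRay r ∧ H.connectedComponentMk (r 0) = c}
  have hS : ∀ c : S, ∃ r, H.IsRay r ∧ H.connectedComponentMk (r 0) = c := fun c ↦ c.2
  choose f hf hfc using hS
  have hmem : ∀ c n, H.connectedComponentMk (f c n) = c := fun c n ↦
    (ConnectedComponent.eq.2 ((hf c).reachable n).symm).trans (hfc c)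
  have hinj : Function.Injective f := fun c c' h ↦
    Subtype.ext (by rw [← hfc c, ← hfc c', h])
  have := hk (Set.range f) (by rintro _ ⟨c, rfl⟩; exact ⟨(hf c).1, fun n ↦ hHG ((hf c).2 n)⟩) (by
    rintro _ ⟨c, rfl⟩ _ ⟨c', rfl⟩ hne
    rw [Function.onFun, Set.disjoint_left]
    rintro _ ⟨m, rfl⟩ ⟨n, heq⟩
    exact hne (congrArg f (Subtype.ext (by rw [← hmem c m, ← hmem c' n, heq]))))
  have hfin : (Set.range f).Finite := Set.finite_of_encard_le_coe this
  exact Set.finite_coe_iff.1 (Set.finite_range_iff hinj |>.1 hfin)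

/-- The first edge is a bridge of the forest `F`, yet the second edge and two paths in `B` would
reconnect its ends without it. -/
theorem IsAcyclic.not_reachable_and_reachable {F B : Set (Sym2 V)}
    (hF : (fromEdgeSet F).IsAcyclic) (hBF : B ⊆ F) {u v u' v' : V} (he : s(u, v) ∈ F \ B)
    (he' : s(u', v') ∈ F \ B) (huv : u ≠ v) (huv' : u' ≠ v') (hne : s(u, v) ≠ s(u', v'))
    (hu : (fromEdgeSet B).Reachable u u') (hv : (fromEdgeSet B).Reachable v v') : False := by
  have hb := isAcyclic_iff_forall_adj_isBridge.1 hF ((fromEdgeSet_adj F).2 ⟨he.1, huv⟩)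
  have hle : fromEdgeSet B ≤ (fromEdgeSet F).deleteEdges {s(u, v)} := by
    intro x y hxy
    rw [fromEdgeSet_adj] at hxy
    rw [deleteEdges_adj, fromEdgeSet_adj]
    exact ⟨⟨hBF hxy.1, hxy.2⟩, fun h ↦ he.2 (Set.mem_singleton_iff.1 h ▸ hxy.1)⟩
  have hadj : ((fromEdgeSet F).deleteEdges {s(u, v)}).Adj u' v' := by
    rw [deleteEdges_adj, fromEdgeSet_adj]
    exact ⟨⟨he'.1, huv'⟩, fun h ↦ hne (Set.mem_singleton_iff.1 h).symm⟩
  exact hb ((hu.mono hle).trans (hadj.reachable.trans (hv.mono hle).symm))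

theorem IsAlgebraicCycleMatroid.nearlyFinitary {G : SimpleGraph V} {M : Matroid (Sym2 V)}
    (hM : G.IsAlgebraicCycleMatroid M) (hG : G.HasFinitelyManyDisjointRays) :
    M.NearlyFinitary := by
  intro F hF
  have hFE : F ⊆ M.E := hF.subset_ground
  obtain ⟨hFG, hac⟩ := hM.finitarization_indep_iff.1 hF.indep
  -- The fundamental circuit of an edge outside `F` in the finitarization is also a circuit of `M`.
  have hspan : M.Spanning F := by
    rw [Matroid.spanning_iff_ground_subset_closure hFE]
    intro e he
    by_cases heF : e ∈ F
    · exact M.mem_closure_of_mem heF hFE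
    · have hC := hF.fundCircuit_isCircuit he heF
      rw [M.finitarization_isCircuit_iff] at hC
      exact (Matroid.mem_closure_iff_exists_isCircuit heF).2
        ⟨_, Matroid.fundCircuit_subset_insert _ _ _, hC.1, Matroid.mem_fundCircuit _ _ _⟩
  obtain ⟨B, hB⟩ := M.exists_isBasis F hFE
  refine ⟨B, hB.isBase_of_spanning hspan, hB.subset, ?_⟩
  set H := fromEdgeSet B
  have hBG : B ⊆ G.edgeSet := hB.subset.trans hFG
  have hHG : H ≤ G := fun x y h ↦ hBG ((fromEdgeSet_adj B).1 h).1
  set S := {c : H.ConnectedComponent | ∃ r, H.IsRay r ∧ H.connectedComponentMk (r 0) = c}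
  have hS : S.Finite := finite_setOf_connectedComponent_of_hasFinitelyManyDisjointRays hHG hG
  have hends : ∀ u v, s(u, v) ∈ F \ B →
      H.connectedComponentMk u ∈ S ∧ H.connectedComponentMk v ∈ S := by
    intro u v he
    have hdep := hB.insert_dep he
    obtain ⟨C, hCs, hC⟩ := hdep.exists_isCircuit_subset
    have hCF : C ⊆ F := hCs.trans (Set.insert_subset he.1 hB.subset)
    have heC : s(u, v) ∈ C := by
      by_contra heC
      exact hC.dep.not_indep (hB.indep.subset ((Set.subset_insert_iff_of_notMem heC).1 hCs))
    obtain ⟨d, hd, rfl⟩ := ((hM.2 C).1 hC).resolve_left fun h ↦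
      (isAcyclic_fromEdgeSet_iff hFG).1 hac C h hCF
    obtain ⟨n, hn⟩ := heC
    have hmem : ∀ m, m ≠ n → s(d m, d (m + 1)) ∈ B := fun m hm ↦
      (hCs ⟨m, rfl⟩).resolve_left fun h ↦ hm (hd.sym2_injective (h.trans hn.symm))
    have h1 : H.connectedComponentMk (d n) ∈ S := by
      refine ⟨_, (hd.isRay_sub n).fromEdgeSet fun k ↦ ?_, by simp⟩
      have := hmem (n - (k + 1 : ℕ)) (by omega)
      rw [Sym2.eq_swap]
      convert this using 3
      push_cast
      ring
    have h2 : H.connectedComponentMk (d (n + 1)) ∈ S := by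
      refine ⟨_, (hd.isRay_add (n + 1)).fromEdgeSet fun k ↦ ?_, by simp⟩
      have := hmem (n + 1 + k) (by omega)
      simpa [add_assoc] using this
    rcases Sym2.eq_iff.1 hn with ⟨rfl, rfl⟩ | ⟨rfl, rfl⟩
    · exact ⟨h1, h2⟩
    · exact ⟨h2, h1⟩
  have hne : ∀ u v, s(u, v) ∈ F \ B → u ≠ v := fun u v h ↦ G.ne_of_adj (hFG h.1)
  -- Send an edge to the pair of components of `B` that it joins: finitely many values, and
  -- injective on `F \ B`.
  refine Set.Finite.of_finite_image (f := Sym2.map H.connectedComponentMk)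
    ((hS.image2 (fun x y ↦ s(x, y)) hS).subset ?_) ?_
  · rintro _ ⟨e, he, rfl⟩
    induction e with | h u v =>
    exact ⟨_, (hends u v he).1, _, (hends u v he).2, rfl⟩
  · intro e he f hf heq
    induction e with | h u v =>
    induction f with | h u' v' =>
    by_contra hef
    rcases Sym2.eq_iff.1 heq with ⟨h1, h2⟩ | ⟨h1, h2⟩
    · exact hac.not_reachable_and_reachable hB.subset he hf (hne _ _ he) (hne _ _ hf) hef
        (ConnectedComponent.eq.1 h1) (ConnectedComponent.eq.1 h2)
    · rw [Sym2.eq_swap (a := u')] at hf hef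
      exact hac.not_reachable_and_reachable hB.subset he hf (hne _ _ he) (hne _ _ hf) hef
        (ConnectedComponent.eq.1 h1) (ConnectedComponent.eq.1 h2)

/-! ### Infinitely many disjoint rays in a connected graph preclude nearly finitary -/

theorem isAcyclic_fromEdgeSet_of_disjoint_rays {G : SimpleGraph V} {ι : Type*} {r : ι → ℕ → V}
    (hr : ∀ i, G.IsRay (r i)) (hd : ∀ i j m n, r i m = r j n → i = j) :
    (fromEdgeSet (Set.range fun q : ι × ℕ ↦ s(r q.1 q.2, r q.1 (q.2 + 1)))).IsAcyclic := by
  rw [isAcyclic_iff_forall_isBridge]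
  intro e he
  rw [edgeSet_fromEdgeSet] at he
  obtain ⟨⟨⟨i, m⟩, rfl⟩, -⟩ := he
  rw [isBridge_iff]
  simp only
  set H := (fromEdgeSet (Set.range fun q : ι × ℕ ↦ s(r q.1 q.2, r q.1 (q.2 + 1)))).deleteEdges
    {s(r i m, r i (m + 1))}
  -- Every edge is a bridge: once it is deleted, no edge leaves the initial segment of the ray
  -- before it.
  have hadj : ∀ x y, H.Adj x y → x ∈ r i '' Set.Iic m → y ∈ r i '' Set.Iic m := by
    rintro _ y hxy ⟨k, hk, rfl⟩
    rw [deleteEdges_adj, fromEdgeSet_adj] at hxy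
    obtain ⟨⟨⟨⟨j, l⟩, hjl⟩, -⟩, hne⟩ := hxy
    rcases Sym2.eq_iff.1 hjl with ⟨h1, rfl⟩ | ⟨rfl, h1⟩
    · obtain rfl := hd _ _ _ _ h1
      obtain rfl := (hr j).1 h1
      refine ⟨l + 1, ?_, rfl⟩
      have : l ≠ m := by rintro rfl; exact hne rfl
      exact lt_of_le_of_ne hk this
    · obtain rfl := hd _ _ _ _ h1
      have := (hr j).1 h1
      exact ⟨l, by simp only [Set.mem_Iic] at hk ⊢; omega, rfl⟩
  rintro ⟨w⟩
  have hw : ∀ x y, H.Walk x y → x ∈ r i '' Set.Iic m → y ∈ r i '' Set.Iic m := by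
    intro x y w
    induction w with
    | nil => exact id
    | cons h _ ih => exact fun hx ↦ ih (hadj _ _ h hx)
  obtain ⟨k, hk, heq⟩ := hw _ _ w ⟨m, Set.mem_Iic.2 le_rfl, rfl⟩
  have := (hr i).1 heq
  simp only [Set.mem_Iic] at hk
  omega

/-- An edge of `G` between two components of the maximal forest `T` could be added to it. -/
theorem IsAlgebraicCycleMatroid.reachable_fromEdgeSet {G : SimpleGraph V} {M : Matroid (Sym2 V)}
    (hM : G.IsAlgebraicCycleMatroid M) {T : Set (Sym2 V)} (hT : M.finitarization.IsBase T)
    {u v : V} (huv : G.Reachable u v) : (fromEdgeSet T).Reachable u v := by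
  have hadj : ∀ u v, G.Adj u v → (fromEdgeSet T).Reachable u v := by
    intro u v huv
    by_contra hn
    have hac := (hM.finitarization_indep_iff.1 hT.indep)
    have hnT : s(u, v) ∉ T := fun h ↦ hn ((fromEdgeSet_adj T).2 ⟨h, huv.ne⟩).reachable
    have hE : s(u, v) ∈ M.finitarization.E := by
      rw [M.finitarization_ground, hM.1]
      exact huv
    refine (hT.insert_dep ⟨hE, hnT⟩).not_indep (hM.finitarization_indep_iff.2
      ⟨Set.insert_subset huv hac.1, (hac.2.sup_edge_of_not_reachable hn).anti ?_⟩)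
    rw [edge, ← fromEdgeSet_union, Set.union_singleton]
  obtain ⟨w⟩ := huv
  induction w with
  | nil => rfl
  | cons h _ ih => exact (hadj _ _ h).trans ih

theorem Walk.reachable_or_exists_reachable_of_diff {T B : Set (Sym2 V)} {u v : V}
    (w : (fromEdgeSet T).Walk u v) :
    (fromEdgeSet B).Reachable u v ∨ ∃ e ∈ T \ B, ∃ x ∈ e, (fromEdgeSet B).Reachable u x := by
  induction w with
  | nil => exact .inl .rfl
  | @cons u x v h _ ih =>
    rw [fromEdgeSet_adj] at h
    by_cases hB : s(u, x) ∈ B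
    · have hux := ((fromEdgeSet_adj B).2 ⟨hB, h.2⟩).reachable
      rcases ih with ih | ⟨e, he, y, hy, hxy⟩
      · exact .inl (hux.trans ih)
      · exact .inr ⟨e, he, y, hy, hux.trans hxy⟩
    · exact .inr ⟨_, ⟨h.1, hB⟩, u, Sym2.mem_mk_left _ _, .rfl⟩

/-- Follow a walk in `T` to a fixed vertex up to its first edge outside `B`. So every vertex is
connected in `B` to the fixed vertex or to one of the finitely many ends of edges in `T \ B`; then
pigeonhole. -/
theorem Connected.exists_reachable_of_finite_diff {T B : Set (Sym2 V)}
    (hT : ∀ u v, (fromEdgeSet T).Reachable u v) (hfin : (T \ B).Finite) {ι : Type*}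
    [Infinite ι] (f : ι → V) : ∃ i j, i ≠ j ∧ (fromEdgeSet B).Reachable (f i) (f j) := by
  obtain ⟨i₀⟩ : Nonempty ι := inferInstance
  have hX : (insert (f i₀) {x | ∃ e ∈ T \ B, x ∈ e}).Finite := by
    refine Set.Finite.insert _ ?_
    have : {x | ∃ e ∈ T \ B, x ∈ e} = ⋃ e ∈ T \ B, {x | x ∈ e} := by ext; simp
    rw [this]
    refine hfin.biUnion fun e _ ↦ ?_
    induction e with | h u v =>
    refine (Set.toFinite {u, v}).subset fun x hx ↦ ?_
    simpa using hx
  have hreach : ∀ i, ∃ x ∈ insert (f i₀) {x | ∃ e ∈ T \ B, x ∈ e},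
      (fromEdgeSet B).Reachable (f i) x := by
    intro i
    obtain ⟨w⟩ := hT (f i) (f i₀)
    rcases w.reachable_or_exists_reachable_of_diff (B := B) with h | ⟨e, he, x, hx, h⟩
    · exact ⟨_, Set.mem_insert _ _, h⟩
    · exact ⟨x, Set.mem_insert_of_mem _ ⟨e, he, hx⟩, h⟩
  choose g hg hfg using hreach
  have := hX.to_subtype
  obtain ⟨i, j, hne, hij⟩ := Finite.exists_ne_map_eq_of_infinite
    fun i ↦ (⟨g i, hg i⟩ : ↥(insert (f i₀) {x | ∃ e ∈ T \ B, x ∈ e}))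
  refine ⟨i, j, hne, (hfg i).trans ?_⟩
  rw [Subtype.mk.inj hij]
  exact (hfg j).symm

theorem IsAlgebraicCycleMatroid.not_nearlyFinitary {G : SimpleGraph V} {M : Matroid (Sym2 V)}
    (hM : G.IsAlgebraicCycleMatroid M) (hG : G.Connected) {ι : Type*} [Infinite ι]
    {r : ι → ℕ → V} (hr : ∀ i, G.IsRay (r i)) (hd : ∀ i j m n, r i m = r j n → i = j) :
    ¬ M.NearlyFinitary := by
  intro hnf
  set F := Set.range fun q : ι × ℕ ↦ s(r q.1 q.2, r q.1 (q.2 + 1))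
  obtain ⟨T, hT, hFT⟩ := (hM.finitarization_indep_iff.2
    ⟨by rintro _ ⟨q, rfl⟩; exact (hr q.1).2 q.2,
      isAcyclic_fromEdgeSet_of_disjoint_rays hr hd⟩).exists_isBase_superset
  obtain ⟨B, hB, hBT, hfin⟩ := hnf T hT
  -- Missing edges chosen from different rays are distinct, since the rays are disjoint.
  have hbad : {i | ∃ n, s(r i n, r i (n + 1)) ∉ B}.Finite := by
    choose! n hn using fun i (h : ∃ n, s(r i n, r i (n + 1)) ∉ B) ↦ h
    refine Set.Finite.of_injOn (f := fun i ↦ s(r i (n i), r i (n i + 1))) (t := T \ B)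
      (fun i hi ↦ ⟨hFT ⟨(i, n i), rfl⟩, hn i hi⟩) (fun i _ j _ heq ↦ ?_) hfin
    rcases Sym2.eq_iff.1 heq with ⟨h, -⟩ | ⟨h, -⟩ <;> exact hd _ _ _ _ h
  have hgood : Infinite ↥({i | ∃ n, s(r i n, r i (n + 1)) ∉ B}ᶜ) :=
    hbad.infinite_compl.to_subtype
  obtain ⟨i, j, hij, hreach⟩ := Connected.exists_reachable_of_finite_diff
    (fun u v ↦ hM.reachable_fromEdgeSet hT (hG.preconnected u v)) hfin
    fun i : ↥({i | ∃ n, s(r i n, r i (n + 1)) ∉ B}ᶜ) ↦ r i 0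
  have hray : ∀ i : ↥({i | ∃ n, s(r i n, r i (n + 1)) ∉ B}ᶜ), (fromEdgeSet B).IsRay (r i) :=
    fun i ↦ (hr i).fromEdgeSet fun n ↦ by
      by_contra h
      exact i.2 ⟨n, h⟩
  obtain ⟨d, hdr⟩ := (hray i).exists_isDoubleRay_of_reachable (hray j) (by
    rw [Set.disjoint_left]
    rintro _ ⟨m, rfl⟩ ⟨n, h⟩
    exact hij (Subtype.ext (hd _ _ _ _ h.symm))) hreach
  have hdB : ∀ n, s(d n, d (n + 1)) ∈ B := fun n ↦ ((fromEdgeSet_adj B).1 (hdr.2 n)).1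
  have hC : M.IsCircuit (Set.range fun n : ℤ ↦ s(d n, d (n + 1))) :=
    (hM.2 _).2 (.inr ⟨d, ⟨hdr.1, fun n ↦ hM.1.subset (hB.subset_ground (hdB n))⟩, rfl⟩)
  exact hC.dep.not_indep (hB.indep.subset (Set.range_subset_iff.2 hdB))

/-! ### Halin's theorem via stable matchings -/

variable {ι κ : Type*}

/-- `r` restricted to the index set `A` is a family of pairwise disjoint rays of `G`. -/
def IsRayFamilyOn (G : SimpleGraph V) (A : Finset ι) (r : ι → ℕ → V) : Prop :=
  (∀ i ∈ A, ∀ n, G.Adj (r i n) (r i (n + 1))) ∧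
    ∀ i ∈ A, ∀ j ∈ A, ∀ m n, r i m = r j n → i = j ∧ m = n

/-- Every vertex of a ray `r i` before position `p i` that lies on a ray `s k` is beaten: the
current vertex of some ray `r i'` lies on `s k` at a later position. -/
def BeatenBefore (A : Finset ι) (W : Finset κ) (r : ι → ℕ → V) (s : κ → ℕ → V) (p : ι → ℕ) :
    Prop :=
  ∀ i ∈ A, ∀ m < p i, ∀ k ∈ W, ∀ a, r i m = s k a → ∃ i' ∈ A, ∃ b, r i' (p i') = s k b ∧ a < b

/-- Ray `i` may move on if any `s k` through its current vertex is held further along by another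
ray; whatever that vertex beat, the later one beats too. -/
theorem BeatenBefore.update [DecidableEq ι] {A : Finset ι} {W : Finset κ} {r : ι → ℕ → V}
    {s : κ → ℕ → V} {p : ι → ℕ} (hp : BeatenBefore A W r s p)
    {i : ι} (h : ∀ k ∈ W, ∀ b, r i (p i) = s k b →
      ∃ i' ∈ A, i' ≠ i ∧ ∃ b', b < b' ∧ r i' (p i') = s k b') :
    BeatenBefore A W r s (Function.update p i (p i + 1)) := by
  have key : ∀ k ∈ W, ∀ a, (∃ i' ∈ A, ∃ b, r i' (p i') = s k b ∧ a ≤ b ∧ (i' = i ∨ a < b)) →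
      ∃ i' ∈ A, ∃ b, r i' (Function.update p i (p i + 1) i') = s k b ∧ a < b := by
    rintro k hk a ⟨i', hi', b, hb, hab, hor⟩
    by_cases hii : i' = i
    · subst hii
      obtain ⟨i'', hi'', hne, b', hbb, heq⟩ := h k hk b hb
      exact ⟨i'', hi'', b', by rwa [Function.update_of_ne hne], hab.trans_lt hbb⟩
    · exact ⟨i', hi', b, by rwa [Function.update_of_ne hii], by tauto⟩
  intro i₁ hi₁ m hm k hk a ha
  by_cases hm' : m < p i₁
  · obtain ⟨i', hi', b, hb, hab⟩ := hp i₁ hi₁ m hm' k hk a ha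
    exact key k hk a ⟨i', hi', b, hb, hab.le, .inr hab⟩
  · by_cases hii : i₁ = i
    · subst hii
      rw [Function.update_self] at hm
      obtain rfl : m = p i₁ := by omega
      exact key k hk a ⟨i₁, hi₁, a, ha, le_rfl, .inl rfl⟩
    · rw [Function.update_of_ne hii] at hm
      exact absurd hm hm'

/-- Bounds the advance: had ray `i` passed more than `|A|` of the rays `s k`, each of these would
hold the current vertex of a different ray in `A`. -/
theorem BeatenBefore.le_of_card_lt {A : Finset ι} {W : Finset κ} {r : ι → ℕ → V}
    {s : κ → ℕ → V} {p : ι → ℕ} (hp : BeatenBefore A W r s p)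
    (hs : ∀ i ∈ W, ∀ j ∈ W, ∀ m n, s i m = s j n → i = j ∧ m = n) {i : ι} (hi : i ∈ A)
    {z : ℕ} {J : Finset κ} (hJ : J ⊆ W) (hcard : A.card < J.card)
    (hz : ∀ k ∈ J, ∃ m < z, ∃ a, r i m = s k a) : p i ≤ z := by
  by_contra! hlt
  refine hcard.not_ge (Finset.card_le_card_of_forall_subsingleton
    (fun k i' ↦ ∃ b, r i' (p i') = s k b) (fun k hk ↦ ?_) (fun i' hi' ↦ ?_))
  · obtain ⟨m, hm, a, ha⟩ := hz k hk
    obtain ⟨i', hi', b, hb, -⟩ := hp i hi m (hm.trans hlt) k (hJ hk) a ha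
    exact ⟨i', hi', b, hb⟩
  · rintro k ⟨hk, b, hb⟩ k' ⟨hk', b', hb'⟩
    exact (hs k (hJ hk) k' (hJ hk') b b' (hb.symm.trans hb')).1

/-- A stable matching of rays: each ray `r i` is assigned a vertex `r i (p i) = s (j i) (b i)` where
it may switch to a ray `s (j i)`. -/
theorem exists_stable_switch [Nonempty κ] {A : Finset ι} {W : Finset κ} {r : ι → ℕ → V} {s : κ → ℕ → V}
    (hr : ∀ i ∈ A, ∀ j ∈ A, ∀ m n, r i m = r j n → i = j ∧ m = n)
    (hs : ∀ i ∈ W, ∀ j ∈ W, ∀ m n, s i m = s j n → i = j ∧ m = n)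
    (hmeet : ∀ i ∈ A, ∃ J ⊆ W, A.card < J.card ∧ ∀ k ∈ J, ∃ m a, r i m = s k a) :
    ∃ (p : ι → ℕ) (j : ι → κ) (b : ι → ℕ), Set.InjOn j A ∧
      (∀ i ∈ A, j i ∈ W ∧ r i (p i) = s (j i) (b i)) ∧
      ∀ i ∈ A, ∀ m < p i, ∀ k ∈ W, ∀ a, r i m = s k a → ∃ i' ∈ A, j i' = k ∧ a < b i' := by
  classical
  have hz : ∀ i ∈ A, ∃ z, ∀ p, BeatenBefore A W r s p → p i ≤ z := by
    intro i hi
    obtain ⟨J, hJW, hcard, hJ⟩ := hmeet i hi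
    choose! m a hma using hJ
    exact ⟨J.sup m + 1, fun p hp ↦ hp.le_of_card_lt hs hi hJW hcard fun k hk ↦
      ⟨m k, Nat.lt_succ_of_le (Finset.le_sup hk), a k, hma k hk⟩⟩
  choose! z hz using hz
  obtain ⟨p, hp, hfin⟩ : ∃ p, BeatenBefore A W r s p ∧ ∀ i ∈ A, ∃ k ∈ W, ∃ b,
      r i (p i) = s k b ∧ ∀ i' ∈ A, i' ≠ i → ∀ b', b < b' → r i' (p i') ≠ s k b' := by
    -- Otherwise some ray can always move on, so the sum of the positions is unbounded, against the
    -- bounds `z`.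
    by_contra! hcon
    have : ∀ n, ∃ p, BeatenBefore A W r s p ∧ n ≤ ∑ i ∈ A, p i := by
      intro n
      induction n with
      | zero => exact ⟨fun _ ↦ 0, fun i _ m hm ↦ absurd hm (Nat.not_lt_zero m), Nat.zero_le _⟩
      | succ n ih =>
        obtain ⟨p, hp, hn⟩ := ih
        obtain ⟨i, hi, h⟩ := hcon p hp
        refine ⟨Function.update p i (p i + 1), hp.update fun k hk b hb ↦ h k hk b hb, ?_⟩
        rw [Finset.sum_update_of_mem hi, ← Finset.add_sum_erase A p hi] at *
        rw [Finset.sdiff_singleton_eq_erase]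
        omega
    obtain ⟨p, hp, hn⟩ := this (∑ i ∈ A, z i + 1)
    have := Finset.sum_le_sum fun i hi ↦ hz i hi p hp
    omega
  choose! j hj b hb hbest using hfin
  refine ⟨p, j, b, ?_, fun i hi ↦ ⟨hj i hi, hb i hi⟩, ?_⟩
  · intro i hi i' hi' heq
    by_contra hne
    rcases lt_trichotomy (b i) (b i') with h | h | h
    · exact hbest i hi i' hi' (Ne.symm hne) _ h (heq ▸ hb i' hi')
    · exact hne (hr i hi i' hi' _ _ (by rw [hb i hi, hb i' hi', heq, h])).1
    · exact hbest i' hi' i hi hne _ h (heq ▸ hb i hi)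
  · intro i hi m hm k hk a ha
    obtain ⟨i', hi', b', hb', hab⟩ := hp i hi m hm k hk a ha
    obtain ⟨h1, h2⟩ := hs _ (hj i' hi') _ hk _ _ ((hb i' hi').symm.trans hb')
    exact ⟨i', hi', h1, h2 ▸ hab⟩

/-- Discard from `A` the rays that meet few of the rays in `W`, and from `W` the rays met by
discarded ones. -/
theorem exists_refinement [DecidableEq ι] (r : ι → ℕ → V) (s : κ → ℕ → V) (N : ℕ) (A : Finset ι)
    (W : Finset κ) (hW : N * A.card + N ≤ W.card) :
    ∃ A' ⊆ A, ∃ W' ⊆ W, N * A'.card + N ≤ W'.card ∧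
      (∀ i ∈ A, i ∉ A' → ∀ k ∈ W', ∀ m a, r i m ≠ s k a) ∧
      ∀ i ∈ A', ∃ J ⊆ W', N < J.card ∧ ∀ k ∈ J, ∃ m a, r i m = s k a := by
  classical
  induction h : A.card generalizing A W with
  | zero =>
    rw [Finset.card_eq_zero] at h
    subst h
    exact ⟨∅, subset_rfl, W, subset_rfl, hW, by simp, by simp⟩
  | succ n ih =>
    let J (i : ι) : Finset κ := {k ∈ W | ∃ m a, r i m = s k a}
    by_cases hall : ∀ i ∈ A, N < (J i).card
    · exact ⟨A, subset_rfl, W, subset_rfl, hW, fun i hi hi' ↦ absurd hi hi', fun i hi ↦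
        ⟨J i, Finset.filter_subset _ _, hall i hi, fun k hk ↦ (Finset.mem_filter.1 hk).2⟩⟩
    -- Discarding `i` costs `W` at most `N` rays, which the bound `N * |A| + N` absorbs.
    · push Not at hall
      obtain ⟨i, hi, hJ⟩ := hall
      have hcard : (A.erase i).card = n := by rw [Finset.card_erase_of_mem hi, h]; rfl
      obtain ⟨A', hA', W', hW', h1, h2, h3⟩ := ih (A.erase i) (W \ J i) (by
        have := Finset.le_card_sdiff (J i) W
        rw [h, mul_add, mul_one] at hW
        rw [hcard]
        omega) hcard
      refine ⟨A', hA'.trans (Finset.erase_subset _ _), W', hW'.trans Finset.sdiff_subset, h1,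
        fun i₁ hi₁ hi₁' k hk m a heq ↦ ?_, h3⟩
      by_cases hii : i₁ = i
      · subst hii
        have := Finset.mem_sdiff.1 (hW' hk)
        exact this.2 (Finset.mem_filter.2 ⟨this.1, m, a, heq⟩)
      · exact h2 i₁ (Finset.mem_erase.2 ⟨hii, hi₁⟩) hi₁' k hk m a heq

/-- Given `n` disjoint rays and many more disjoint rays avoiding initial segments of the former,
there are `n + 1` disjoint rays of which the first `n` extend these initial segments. -/
theorem IsRayFamilyOn.exists_extension {G : SimpleGraph V} {n : ℕ} {r : ℕ → ℕ → V}
    {s : κ → ℕ → V} {W : Finset κ} (hr : G.IsRayFamilyOn (Finset.range n) r)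
    (hs : G.IsRayFamilyOn W s) (hcard : (n + 1) * n + (n + 1) ≤ W.card) (l : ℕ)
    (havoid : ∀ i < n, ∀ m ≤ l, ∀ k ∈ W, ∀ a, r i m ≠ s k a) :
    ∃ t, G.IsRayFamilyOn (Finset.range (n + 1)) t ∧ ∀ i < n, ∀ m ≤ l, t i m = r i m := by
  classical
  obtain ⟨A, hA, W', hW', hcard', hout, hmeet⟩ :=
    exists_refinement r s (n + 1) (Finset.range n) W (by simpa using hcard)
  have hAn : A.card ≤ n := by simpa using Finset.card_le_card hA
  obtain ⟨k, -⟩ := Finset.card_pos.1 (by omega : 0 < W.card)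
  have : Nonempty κ := ⟨k⟩
  obtain ⟨p, j, b, hinj, hjb, hst⟩ := exists_stable_switch
    (fun i hi i' hi' ↦ hr.2 i (hA hi) i' (hA hi'))
    (fun k hk k' hk' ↦ hs.2 k (hW' hk) k' (hW' hk')) (fun i hi ↦ by
      obtain ⟨J, hJ, h1, h2⟩ := hmeet i hi
      exact ⟨J, hJ, by omega, h2⟩)
  -- `W'` keeps at least `n + 1` rays and at most `n` are matched; a spare one becomes the new ray.
  obtain ⟨k₀, hk₀, hk₀j⟩ : ∃ k ∈ W', k ∉ A.image j := by
    refine Finset.exists_mem_notMem_of_card_lt_card ?_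
    have := Finset.card_image_le (s := A) (f := j)
    omega
  have hk₀j : ∀ i ∈ A, j i ≠ k₀ := fun i hi h ↦ hk₀j (Finset.mem_image.2 ⟨i, hi, h⟩)
  let t (i m : ℕ) : V := if i = n then s k₀ m else
    if i ∈ A ∧ p i < m then s (j i) (b i + (m - p i)) else r i m
  have ht₀ : ∀ m, t n m = s k₀ m := fun m ↦ if_pos rfl
  have ht₁ : ∀ i < n, ∀ m, i ∈ A → p i < m → t i m = s (j i) (b i + (m - p i)) := by
    intro i hi m h1 h2
    simp only [t, if_neg hi.ne, if_pos (And.intro h1 h2)]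
  have ht₂ : ∀ i < n, ∀ m, (i ∈ A → m ≤ p i) → t i m = r i m := by
    intro i hi m h
    have : ¬ (i ∈ A ∧ p i < m) := fun h' ↦ (h h'.1).not_gt h'.2
    simp only [t, if_neg hi.ne, if_neg this]
  have hcases : ∀ i < n + 1, ∀ m, (i < n ∧ (i ∈ A → m ≤ p i) ∧ t i m = r i m) ∨
      (i < n ∧ i ∈ A ∧ p i < m ∧ t i m = s (j i) (b i + (m - p i))) ∨
      (i = n ∧ t i m = s k₀ m) := by
    intro i hi m
    by_cases hin : i = n
    · subst hin
      exact .inr (.inr ⟨rfl, ht₀ m⟩)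
    · have hi' : i < n := by omega
      by_cases h : i ∈ A ∧ p i < m
      · exact .inr (.inl ⟨hi', h.1, h.2, ht₁ i hi' m h.1 h.2⟩)
      · have h' : i ∈ A → m ≤ p i := fun h1 ↦ not_lt.1 fun h2 ↦ h ⟨h1, h2⟩
        exact .inl ⟨hi', h', ht₂ i hi' m h'⟩
  -- Stability: the kept part of an old ray meets `s k` only if `k` is matched, and then not beyond
  -- the switching vertex on `s k`. So it avoids the tails in use and `s k₀`.
  have hrs : ∀ i < n, ∀ m, (i ∈ A → m ≤ p i) → ∀ k ∈ W', ∀ a, r i m = s k a →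
      ∃ i' ∈ A, j i' = k ∧ a ≤ b i' := by
    intro i hi m hm k hk a heq
    by_cases hiA : i ∈ A
    · rcases (hm hiA).lt_or_eq with hlt | rfl
      · obtain ⟨i', hi', h1, h2⟩ := hst i hiA m hlt k hk a heq
        exact ⟨i', hi', h1, h2.le⟩
      · obtain ⟨h1, h2⟩ := hs.2 _ (hW' (hjb i hiA).1) _ (hW' hk) _ _
          ((hjb i hiA).2.symm.trans heq)
        exact ⟨i, hiA, h1, h2.ge⟩
    · exact absurd heq (hout i (Finset.mem_range.2 hi) hiA k hk m a)
  have hr_switch : ∀ i < n, ∀ m, (i ∈ A → m ≤ p i) → ∀ i' ∈ A, ∀ c, p i' < c →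
      r i m ≠ s (j i') (b i' + (c - p i')) := by
    intro i hi m hm i' hi' c hc heq
    obtain ⟨i'', hi'', h1, h2⟩ := hrs i hi m hm _ (hjb i' hi').1 _ heq
    obtain rfl := hinj hi'' hi' h1
    omega
  have hr_new : ∀ i < n, ∀ m, (i ∈ A → m ≤ p i) → ∀ c, r i m ≠ s k₀ c := by
    intro i hi m hm c heq
    obtain ⟨i', hi', h1, -⟩ := hrs i hi m hm _ hk₀ _ heq
    exact hk₀j i' hi' h1
  have hswitch_new : ∀ i ∈ A, ∀ a c, s (j i) a ≠ s k₀ c := fun i hi a c heq ↦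
    hk₀j i hi (hs.2 _ (hW' (hjb i hi).1) _ (hW' hk₀) _ _ heq).1
  refine ⟨t, ⟨fun i hi m ↦ ?_, fun i hi i' hi' m m' heq ↦ ?_⟩, fun i hi m hm ↦ ?_⟩
  · rw [Finset.mem_range] at hi
    rcases hcases i hi m with ⟨hi', h1, h2⟩ | ⟨hi', h1, h2, h3⟩ | ⟨rfl, h1⟩
    · rw [h2]
      by_cases h : i ∈ A ∧ p i < m + 1
      · obtain rfl : m = p i := by have := h1 h.1; omega
        rw [ht₁ i hi' _ h.1 h.2, (hjb i h.1).2, Nat.add_sub_cancel_left]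
        exact hs.1 _ (hW' (hjb i h.1).1) _
      · rw [ht₂ i hi' _ fun h1 ↦ not_lt.1 fun h2 ↦ h ⟨h1, h2⟩]
        exact hr.1 i (Finset.mem_range.2 hi') m
    · rw [h3, ht₁ i hi' _ h1 (by omega), Nat.sub_add_comm h2.le, ← add_assoc]
      exact hs.1 _ (hW' (hjb i h1).1) _
    · rw [h1, ht₀]
      exact hs.1 _ (hW' hk₀) _
  · rw [Finset.mem_range] at hi hi'
    rcases hcases i hi m with ⟨hin, h1, h2⟩ | ⟨hin, h1, h2, h3⟩ | ⟨rfl, h1⟩ <;>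
      rcases hcases i' hi' m' with ⟨hin', h1', h2'⟩ | ⟨hin', h1', h2', h3'⟩ | ⟨rfl, h1'⟩
    · rw [h2, h2'] at heq
      exact hr.2 i (Finset.mem_range.2 hin) i' (Finset.mem_range.2 hin') _ _ heq
    · rw [h2, h3'] at heq
      exact absurd heq (hr_switch i hin m h1 i' h1' m' h2')
    · rw [h2, h1'] at heq
      exact absurd heq (hr_new i hin m h1 m')
    · rw [h3, h2'] at heq
      exact absurd heq.symm (hr_switch i' hin' m' h1' i h1 m h2)
    · rw [h3, h3'] at heq
      obtain ⟨e1, e2⟩ := hs.2 _ (hW' (hjb i h1).1) _ (hW' (hjb i' h1').1) _ _ heq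
      obtain rfl := hinj h1 h1' e1
      exact ⟨rfl, by omega⟩
    · rw [h3, h1'] at heq
      exact absurd heq (hswitch_new i h1 _ _)
    · rw [h1, h2'] at heq
      exact absurd heq.symm (hr_new i' hin' m' h1' m)
    · rw [h1, h3'] at heq
      exact absurd heq.symm (hswitch_new i' h1' _ _)
    · rw [h1, h1'] at heq
      exact ⟨rfl, (hs.2 _ (hW' hk₀) _ (hW' hk₀) _ _ heq).2⟩
  -- Switching vertices lie on rays of `W`, so by `havoid` no switch occurs up to position `l`.
  · refine ht₂ i hi m fun hiA ↦ hm.trans (not_lt.1 fun hlt ↦ ?_)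
    exact havoid i hi (p i) hlt.le _ (hW' (hjb i hiA).1) _ (hjb i hiA).2

theorem isRayFamilyOn_id {G : SimpleGraph V} {W : Finset (ℕ → V)} (hW : ∀ r ∈ W, G.IsRay r)
    (hd : (W : Set (ℕ → V)).PairwiseDisjoint Set.range) : G.IsRayFamilyOn W id := by
  refine ⟨fun r hr ↦ (hW r hr).2, fun r hr s hs m n heq ↦ ?_⟩
  obtain rfl : r = s := by
    by_contra hne
    exact Set.disjoint_left.1 (hd hr hs hne) ⟨m, heq⟩ ⟨n, rfl⟩
  exact ⟨rfl, (hW r hr).1 heq⟩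

/-- The theorem of Halin: a graph with arbitrarily many disjoint rays has infinitely many. -/
theorem exists_nat_family_of_not_hasFinitelyManyDisjointRays {G : SimpleGraph V}
    (hG : ¬ G.HasFinitelyManyDisjointRays) :
    ∃ r : ℕ → ℕ → V, (∀ i, G.IsRay (r i)) ∧ ∀ i j m n, r i m = r j n → i = j := by
  classical
  have hmany : ∀ k : ℕ, ∃ W : Finset (ℕ → V), W.card = k ∧ G.IsRayFamilyOn W id := by
    intro k
    simp only [HasFinitelyManyDisjointRays, not_exists, not_forall, not_le] at hG
    obtain ⟨R, hR, hd, hk⟩ := hG k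
    obtain ⟨W, hWR, hW⟩ := Set.exists_subset_encard_eq hk.le
    have hfin : W.Finite := Set.finite_of_encard_eq_coe hW
    refine ⟨hfin.toFinset, ?_, isRayFamilyOn_id (fun r hr ↦ hR r (hWR (by simpa using hr)))
      (hd.subset (by simpa using hWR))⟩
    rw [hfin.encard_eq_coe_toFinset_card] at hW
    exact_mod_cast hW
  have hstep : ∀ n, ∀ r : ℕ → ℕ → V, G.IsRayFamilyOn (Finset.range n) r →
      ∃ t, G.IsRayFamilyOn (Finset.range (n + 1)) t ∧ ∀ i < n, ∀ m ≤ n, t i m = r i m := by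
    intro n r hr
    let X : Finset V := (Finset.range n ×ˢ Finset.range (n + 1)).image fun q ↦ r q.1 q.2
    obtain ⟨W, hcard, hW⟩ := hmany (X.card + ((n + 1) * n + (n + 1)))
    -- Each vertex of `X` lies on at most one ray of `W`, so removing the rays that meet `X` costs
    -- at most `|X|`.
    let D : Finset (ℕ → V) := {k ∈ W | ∃ a, k a ∈ X}
    have hD : D.card ≤ X.card := by
      refine Finset.card_le_card_of_forall_subsingleton (fun k x ↦ ∃ a, k a = x)
        (fun k hk ↦ ?_) (fun x _ ↦ ?_)
      · obtain ⟨a, ha⟩ := (Finset.mem_filter.1 hk).2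
        exact ⟨k a, ha, a, rfl⟩
      · rintro k ⟨hk, a, ha⟩ k' ⟨hk', a', ha'⟩
        exact (hW.2 k (Finset.mem_filter.1 hk).1 k' (Finset.mem_filter.1 hk').1 a a'
          (ha.trans ha'.symm)).1
    refine hr.exists_extension (W := W \ D) (s := id)
      ⟨fun k hk ↦ hW.1 k (Finset.sdiff_subset hk), fun k hk k' hk' ↦
        hW.2 k (Finset.sdiff_subset hk) k' (Finset.sdiff_subset hk')⟩ ?_ n ?_
    · have := Finset.le_card_sdiff D W
      omega
    · intro i hi m hm k hk a heq
      obtain ⟨h1, h2⟩ := Finset.mem_sdiff.1 hk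
      refine h2 (Finset.mem_filter.2 ⟨h1, a, Finset.mem_image.2 ⟨(i, m), ?_, heq⟩⟩)
      simp only [Finset.mem_product, Finset.mem_range]
      omega
  choose! f hf hfeq using hstep
  obtain ⟨v⟩ : Nonempty V := by
    obtain ⟨W, hW, -⟩ := hmany 1
    obtain ⟨w, -⟩ := Finset.card_pos.1 (by omega : 0 < W.card)
    exact ⟨w 0⟩
  -- The family at stage zero is empty, so the constant `v` is only a filler.
  let T : ℕ → ℕ → ℕ → V := fun n ↦ Nat.rec (fun _ _ ↦ v) (fun n r ↦ f n r) n
  have hT : ∀ n, G.IsRayFamilyOn (Finset.range n) (T n) := by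
    intro n
    induction n with
    | zero => exact ⟨by simp, by simp⟩
    | succ n ih => exact hf n (T n) ih
  -- Vertex `m` of ray `i` is frozen from stage `i + m + 1` on; the limit rays are read off there
  -- and compared at a common later stage.
  have hTeq : ∀ i m n, i + m < n → T n i m = T (i + m + 1) i m := by
    intro i m n hn
    induction n, hn using Nat.le_induction with
    | base => rfl
    | succ n hn ih =>
      rw [← ih]
      exact hfeq n (T n) (hT n) i (by omega) m (by omega)
  refine ⟨fun i m ↦ T (i + m + 1) i m, fun i ↦ ⟨fun m n heq ↦ ?_, fun m ↦ ?_⟩,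
    fun i j m n heq ↦ ?_⟩
  · simp only at heq
    rw [← hTeq i m (i + m + n + 1) (by omega), ← hTeq i n (i + m + n + 1) (by omega)] at heq
    exact ((hT (i + m + n + 1)).2 i (by simp; omega) i (by simp; omega) _ _ heq).2
  · simp only
    rw [← hTeq i m (i + (m + 1) + 1) (by omega)]
    exact (hT (i + (m + 1) + 1)).1 i (Finset.mem_range.2 (by omega)) m
  · simp only at heq
    rw [← hTeq i m (i + m + j + n + 1) (by omega), ← hTeq j n (i + m + j + n + 1) (by omega)] at heq
    exact ((hT (i + m + j + n + 1)).2 i (by simp; omega) j (by simp; omega) _ _ heq).1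

end SimpleGraph

theorem mainTheorem4 {V : Type*} (G : SimpleGraph V) (M : Matroid (Sym2 V))
    (hM : G.IsAlgebraicCycleMatroid M) :
    (G.HasFinitelyManyDisjointRays → M.NearlyFinitary) ∧
      (G.Connected → (M.NearlyFinitary ↔ G.HasFinitelyManyDisjointRays)) := by
  refine ⟨hM.nearlyFinitary, fun hG ↦ ⟨fun hnf ↦ ?_, hM.nearlyFinitary⟩⟩
  by_contra hrays
  obtain ⟨r, hr, hd⟩ :=
    SimpleGraph.exists_nat_family_of_not_hasFinitelyManyDisjointRays hrays
  exact hM.not_nearlyFinitary hG hr hd hnf
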